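/- A COFE is a set with a decreasing sequence of equivalence relations $=_n$ ($n\in\mathbb N$) whose intersection is equality and in which every chain (a sequence $c$ with $c_m =_n c_n$ for all $m\ge n$) has a limit (an $x$ with $x =_n c_n$ for all $n$). COFEs form a category with the non-expansive functions (those preserving every $=_n$) as morphisms, and $A \to B$ between COFEs denotes the COFE of non-expansive functions with pointwise $=_n$. Sums, products, and functions out of a plain set carry the evident COFE structure. The COFE $\blacktriangleright A$ has the same elements as $A$, with $x =_n y$ in $\blacktriangleright A$ iff $x =_m y$ in $A$ for all $m<n$. Let $\mathrm{Val}$ be a set and $\mathrm{Action}=\{\mathsf{send},\mathsf{recv}\}$ (discrete). (1) For all COFEs $X^-,X^+$, the endofunctor on COFEs $$F_{X^-,X^+}(B) = 1 + \Big(\mathrm{Action} \times \big(\mathrm{Val} \to \blacktriangleright\big(1 + (\mathrm{Action}\times(\mathrm{Val}\to \blacktriangleright B \to X^-))\big) \to X^+\big)\Big)$$ is locally contractive (if $f =_m g$ for all $m<n$, then $F_{X^-,X^+}(f) =_n F_{X^-,X^+}(g)$), and the fixed-polarity recursive domain equation $$\mathrm{iProto}_2(X^-,X^+) \cong F_{X^-,X^+}\big(\mathrm{iProto}_2(X^-,X^+)\big)$$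 has a solution among COFEs. (2) There is a bifunctor $\mathrm{iProto}(X^-,X^+)$ from COFEs to COFEs, contravariant in $X^-$, covariant in $X^+$ and locally non-expansive (if $f=_n f'$ and $g =_n g'$, then $\mathrm{iProto}(f,g)=_n\mathrm{iProto}(f',g')$), together with an isomorphism of COFEs, natural in $X^-$ and $X^+$, $$\mathrm{iProto}(X^-,X^+) \cong 1 + \big(\mathrm{Action} \times (\mathrm{Val} \to \blacktriangleright \mathrm{iProto}(X^+,X^-) \to X^+)\big),$$ such that for all COFEs $X^-,X^+$, every solution $\mathrm{iProto}_2(X^-,X^+)$ of the equation in (1) is isomorphic to $\mathrm{iProto}(X^-,X^+)$, by an isomorphism of COFEs that commutes with the given isomorphism of $\mathrm{iProto}_2(X^-,X^+)$ and the twofold unfolding $\mathrm{iProto}(X^-,X^+)\cong F_{X^-,X^+}(\mathrm{iProto}(X^-,X^+))$ of the isomorphism above. -/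

import Mathlib

open CategoryTheory Opposite

universe u v w

/-! Ordered families of equivalences (OFEs) and complete OFEs (COFEs). -/

/-- An OFE: a type with a decreasing sequence of equivalence relations (`n`-equality) whose
intersection is equality. -/
class OFE (α : Type u) where
  dist : ℕ → α → α → Prop
  dist_equiv : ∀ n, Equivalence (dist n)
  dist_mono : ∀ {m n : ℕ} {x y : α}, m ≤ n → dist n x y → dist m x y
  eq_of_dist : ∀ {x y : α}, (∀ n, dist n x y) → x = y

/-- A sequence is a chain if its terms from index `n` on are `n`-equal. -/
def OFE.IsChain {α : Type u} [OFE α] (c : ℕ → α) : Prop :=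
  ∀ n m, n ≤ m → OFE.dist n (c m) (c n)

/-- A COFE: an OFE in which every chain has a limit. -/
class COFE (α : Type u) extends OFE α where
  complete : ∀ c : ℕ → α, OFE.IsChain c → ∃ x, ∀ n, OFE.dist n x (c n)

/-- Non-expansive functions between OFEs. -/
@[ext]
structure NonExp (α : Type u) (β : Type v) [OFE α] [OFE β] where
  toFun : α → β
  nonexp : ∀ n x y, OFE.dist n x y → OFE.dist n (toFun x) (toFun y)

/-- Non-expansive functions form an OFE, with pointwise `n`-equality. -/
instance NonExp.instOFE {α : Type u} {β : Type v} [OFE α] [OFE β] : OFE (NonExp α β) where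
  dist n f g := ∀ x, OFE.dist n (f.toFun x) (g.toFun x)
  dist_equiv n :=
    ⟨fun _ _ => (OFE.dist_equiv n).refl _, fun h x => (OFE.dist_equiv n).symm (h x),
      fun h k x => (OFE.dist_equiv n).trans (h x) (k x)⟩
  dist_mono hmn h x := OFE.dist_mono hmn (h x)
  eq_of_dist h := NonExp.ext (funext fun x => OFE.eq_of_dist fun n => h n x)

instance NonExp.instCOFE {α : Type u} {β : Type v} [OFE α] [COFE β] : COFE (NonExp α β) where
  complete c hc := by
    have h : ∀ x, ∃ y, ∀ n, OFE.dist n y ((c n).toFun x) := fun x =>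
      COFE.complete (fun n => (c n).toFun x) (fun n m hnm => hc n m hnm x)
    choose f hf using h
    refine ⟨⟨f, fun n x y hxy => ?_⟩, fun n x => hf x n⟩
    have E := OFE.dist_equiv (α := β) n
    exact E.trans (hf x n) (E.trans ((c n).nonexp n x y hxy) (E.symm (hf y n)))

/-- The type-level later: the same elements, with `n`-equality delayed by one step. -/
@[ext]
structure Later (α : Type u) where
  next ::
  val : α

instance Later.instOFE {α : Type u} [OFE α] : OFE (Later α) where
  dist n x y := ∀ m, m < n → OFE.dist m x.val y.val
  dist_equiv _ :=
    ⟨fun _ m _ => (OFE.dist_equiv m).refl _, fun h m hm => (OFE.dist_equiv m).symm (h m hm),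
      fun h k m hm => (OFE.dist_equiv m).trans (h m hm) (k m hm)⟩
  dist_mono hmn h k hk := h k (lt_of_lt_of_le hk hmn)
  eq_of_dist h := Later.ext (OFE.eq_of_dist fun n => h (n + 1) n (Nat.lt_succ_self n))

instance Later.instCOFE {α : Type u} [COFE α] : COFE (Later α) where
  complete c hc := by
    obtain ⟨x, hx⟩ := COFE.complete (fun n => (c (n + 1)).val)
      (fun n m hnm => hc (n + 1) (m + 1) (by omega) n (by omega))
    refine ⟨⟨x⟩, fun n m hmn => ?_⟩
    have E := OFE.dist_equiv (α := α) m
    exact E.trans (hx m) (E.symm (hc (m + 1) n hmn m (by omega)))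

/-- Functions out of a plain type, with pointwise `n`-equality. -/
instance Pi.instOFE' {ι : Type v} {α : Type u} [OFE α] : OFE (ι → α) where
  dist n f g := ∀ i, OFE.dist n (f i) (g i)
  dist_equiv n :=
    ⟨fun _ _ => (OFE.dist_equiv n).refl _, fun h x => (OFE.dist_equiv n).symm (h x),
      fun h k x => (OFE.dist_equiv n).trans (h x) (k x)⟩
  dist_mono hmn h x := OFE.dist_mono hmn (h x)
  eq_of_dist h := funext fun x => OFE.eq_of_dist fun n => h n x

instance Pi.instCOFE' {ι : Type v} {α : Type u} [COFE α] : COFE (ι → α) where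
  complete c hc := by
    have h : ∀ i, ∃ y, ∀ n, OFE.dist n y (c n i) := fun i =>
      COFE.complete (fun n => c n i) (fun n m hnm => hc n m hnm i)
    choose f hf using h
    exact ⟨f, fun n i => hf i n⟩

/-- Binary products, with componentwise `n`-equality. -/
instance Prod.instOFE' {α : Type u} {β : Type v} [OFE α] [OFE β] : OFE (α × β) where
  dist n x y := OFE.dist n x.1 y.1 ∧ OFE.dist n x.2 y.2
  dist_equiv n :=
    ⟨fun _ => ⟨(OFE.dist_equiv n).refl _, (OFE.dist_equiv n).refl _⟩,
      fun h => ⟨(OFE.dist_equiv n).symm h.1, (OFE.dist_equiv n).symm h.2⟩,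
      fun h k => ⟨(OFE.dist_equiv n).trans h.1 k.1, (OFE.dist_equiv n).trans h.2 k.2⟩⟩
  dist_mono hmn h := ⟨OFE.dist_mono hmn h.1, OFE.dist_mono hmn h.2⟩
  eq_of_dist h := Prod.ext (OFE.eq_of_dist fun n => (h n).1) (OFE.eq_of_dist fun n => (h n).2)

instance Prod.instCOFE' {α : Type u} {β : Type v} [COFE α] [COFE β] : COFE (α × β) where
  complete c hc := by
    obtain ⟨x, hx⟩ := COFE.complete (fun n => (c n).1) (fun n m hnm => (hc n m hnm).1)
    obtain ⟨y, hy⟩ := COFE.complete (fun n => (c n).2) (fun n m hnm => (hc n m hnm).2)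
    exact ⟨(x, y), fun n => ⟨hx n, hy n⟩⟩

/-- Binary sums: `n`-equal elements lie in the same summand and are `n`-equal there. -/
instance Sum.instOFE' {α : Type u} {β : Type v} [OFE α] [OFE β] : OFE (α ⊕ β) where
  dist n := Sum.LiftRel (OFE.dist n) (OFE.dist n)
  dist_equiv n := by
    have E := OFE.dist_equiv (α := α) n
    have E' := OFE.dist_equiv (α := β) n
    refine ⟨?_, ?_, ?_⟩
    · rintro (x | x)
      · exact .inl (E.refl _)
      · exact .inr (E'.refl _)
    · rintro _ _ (h | h)
      · exact .inl (E.symm h)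
      · exact .inr (E'.symm h)
    · rintro _ _ _ (h | h) (k | k)
      · exact .inl (E.trans h k)
      · exact .inr (E'.trans h k)
  dist_mono := by
    rintro m n _ _ hmn (h | h)
    · exact .inl (OFE.dist_mono hmn h)
    · exact .inr (OFE.dist_mono hmn h)
  eq_of_dist := by
    rintro (x | x) (y | y) h
    · exact congrArg _ (OFE.eq_of_dist fun n => Sum.liftRel_inl_inl.1 (h n))
    · exact absurd (h 0) Sum.not_liftRel_inl_inr
    · exact absurd (h 0) Sum.not_liftRel_inr_inl
    · exact congrArg _ (OFE.eq_of_dist fun n => Sum.liftRel_inr_inr.1 (h n))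

instance Sum.instCOFE' {α : Type u} {β : Type v} [COFE α] [COFE β] : COFE (α ⊕ β) where
  complete c hc := by
    have hc' : ∀ n m, n ≤ m → Sum.LiftRel (OFE.dist n) (OFE.dist n) (c m) (c n) := hc
    rcases h0 : c 0 with a | b
    · have h : ∀ n, ∃ x, c n = Sum.inl x := fun n => by
        have := hc' 0 n (Nat.zero_le n)
        rw [h0] at this
        rcases hn : c n with x | x
        · exact ⟨x, rfl⟩
        · rw [hn] at this; exact absurd this Sum.not_liftRel_inr_inl
      choose d hd using h
      obtain ⟨x, hx⟩ := COFE.complete d (fun n m hnm => by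
        have := hc' n m hnm
        rw [hd, hd] at this
        exact Sum.liftRel_inl_inl.1 this)
      exact ⟨Sum.inl x, fun n => by rw [hd]; exact .inl (hx n)⟩
    · have h : ∀ n, ∃ x, c n = Sum.inr x := fun n => by
        have := hc' 0 n (Nat.zero_le n)
        rw [h0] at this
        rcases hn : c n with x | x
        · rw [hn] at this; exact absurd this Sum.not_liftRel_inl_inr
        · exact ⟨x, rfl⟩
      choose d hd using h
      obtain ⟨x, hx⟩ := COFE.complete d (fun n m hnm => by
        have := hc' n m hnm
        rw [hd, hd] at this
        exact Sum.liftRel_inr_inr.1 this)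
      exact ⟨Sum.inr x, fun n => by rw [hd]; exact .inr (hx n)⟩

/-- The discrete COFE structure on a type: `n`-equality is equality. -/
@[reducible]
def COFE.discrete (α : Type u) : COFE α where
  dist _ x y := x = y
  dist_equiv _ := eq_equivalence
  dist_mono _ h := h
  eq_of_dist h := h 0
  complete c hc := ⟨c 0, fun n => (hc 0 n (Nat.zero_le n)).symm⟩

instance PUnit.instCOFE' : COFE PUnit.{u + 1} := COFE.discrete _

/-- Actions: sending or receiving. -/
inductive ProtoAction : Type
  | send
  | recv

instance ProtoAction.instCOFE : COFE ProtoAction := COFE.discrete _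

/-! The category of COFEs and non-expansive functions. -/

/-- A bundled COFE. -/
structure CofeCat : Type (u + 1) where
  carrier : Type u
  [str : COFE carrier]

attribute [instance] CofeCat.str

instance CofeCat.instCategory : Category.{u} CofeCat.{u} where
  Hom A B := NonExp A.carrier B.carrier
  id A := ⟨fun x => x, fun _ _ _ h => h⟩
  comp f g := ⟨fun x => g.toFun (f.toFun x), fun n _ _ h => g.nonexp n _ _ (f.nonexp n _ _ h)⟩

/-- `n`-equality of morphisms (pointwise `n`-equality). -/
def CofeCat.HomDist {A B : CofeCat.{u}} (n : ℕ) (f g : A ⟶ B) : Prop :=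
  OFE.dist (α := NonExp A.carrier B.carrier) n f g

/-- An endofunctor of COFEs is locally contractive if its action on morphisms is contractive. -/
def LocallyContractive (F : CofeCat.{u} ⥤ CofeCat.{v}) : Prop :=
  ∀ (A B : CofeCat.{u}) (f g : A ⟶ B) (n : ℕ),
    (∀ m, m < n → CofeCat.HomDist m f g) → CofeCat.HomDist n (F.map f) (F.map g)

/-- A mixed-variance bifunctor on COFEs is locally non-expansive if its action on (pairs of)
morphisms is non-expansive. -/
def LocallyNonExpansive (P : CofeCat.{u}ᵒᵖ × CofeCat.{v} ⥤ CofeCat.{w}) : Prop :=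
  ∀ (A A' : CofeCat.{u}) (B B' : CofeCat.{v}) (f f' : A' ⟶ A) (g g' : B ⟶ B') (n : ℕ),
    CofeCat.HomDist n f f' → CofeCat.HomDist n g g' →
      CofeCat.HomDist n (P.map (X := (op A, B)) (Y := (op A', B')) (f.op, g))
        (P.map (X := (op A, B)) (Y := (op A', B')) (f'.op, g'))

/-- A solution of the recursive domain equation `T ≅ F(T)`. -/
structure Solution (F : CofeCat.{u} ⥤ CofeCat.{u}) where
  car : CofeCat.{u}
  fold : F.obj car ≅ car

/-- Isomorphism of solutions: an isomorphism of COFEs that commutes with the folding maps. -/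
def Solution.Isomorphic {F : CofeCat.{u} ⥤ CofeCat.{u}} (S T : Solution F) : Prop :=
  ∃ h : S.car ≅ T.car, S.fold.hom ≫ h.hom = F.map h.hom ≫ T.fold.hom

/-! The recursive domain equations for protocols. -/

/-- `1 + (Action × (Val → ▶A → X))`, where the inner arrow is the COFE of non-expansive
functions. -/
abbrev ProtoBody (Val : Type v) (A : Type w) (X : Type u) [OFE A] [OFE X] : Type (max u v w) :=
  PUnit.{max u v w + 1} ⊕ (ProtoAction × (Val → NonExp (Later A) X))

/-- The action of `ProtoBody` on `f : A' → A` and `g : X → X'`: it post-composes each predicate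
with `g` and pre-composes it with `▶f`. -/
def ProtoBody.map {Val : Type v} {A A' : Type w} {X X' : Type u} [OFE A] [OFE A'] [OFE X] [OFE X']
    (f : NonExp A' A) (g : NonExp X X') : NonExp (ProtoBody Val A X) (ProtoBody Val A' X') where
  toFun
    | .inl _ => .inl ⟨⟩
    | .inr (a, φ) => .inr (a, fun x =>
        ⟨fun y => g.toFun ((φ x).toFun ⟨f.toFun y.val⟩), fun n _ _ h =>
          g.nonexp n _ _ ((φ x).nonexp n _ _ fun m hm => f.nonexp m _ _ (h m hm))⟩)
  nonexp := by
    rintro n _ _ (h | h)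
    · exact .inl rfl
    · exact .inr ⟨h.1, fun x y => g.nonexp n _ _ (h.2 x _)⟩

/-- The functor `(A, X) ↦ 1 + (Action × (Val → ▶A → X))`, contravariant in `A` and covariant
in `X`. -/
def protoBody (Val : Type v) : CofeCat.{w}ᵒᵖ × CofeCat.{u} ⥤ CofeCat.{max u v w} where
  obj p := ⟨ProtoBody Val p.1.unop.carrier p.2.carrier⟩
  map f := ProtoBody.map f.1.unop f.2
  map_id p := by
    apply NonExp.ext
    funext x
    rcases x with x | x <;> rfl
  map_comp f g := by
    apply NonExp.ext
    funext x
    rcases x with x | x <;> rfl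

/-- For a bifunctor `P`, the bifunctor
`(X⁻, X⁺) ↦ 1 + (Action × (Val → ▶P(X⁺, X⁻) → X⁺))`. -/
def protoRHS (Val : Type v) (P : CofeCat.{u}ᵒᵖ × CofeCat.{u} ⥤ CofeCat.{max u v}) :
    CofeCat.{u}ᵒᵖ × CofeCat.{u} ⥤ CofeCat.{max u v} where
  obj X := (protoBody.{u, v, max u v} Val).obj (op (P.obj (op X.2, X.1.unop)), X.2)
  map {X Y} f := (protoBody.{u, v, max u v} Val).map
    (X := (op (P.obj (op X.2, X.1.unop)), X.2)) (Y := (op (P.obj (op Y.2, Y.1.unop)), Y.2))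
    ((P.map (X := (op Y.2, Y.1.unop)) (Y := (op X.2, X.1.unop)) (f.2.op, f.1.unop)).op, f.2)
  map_id X := by
    have h := P.map_id (op X.2, X.1.unop)
    exact (congrArg (fun k => (protoBody.{u, v, max u v} Val).map
      (X := (op (P.obj (op X.2, X.1.unop)), X.2)) (Y := (op (P.obj (op X.2, X.1.unop)), X.2))
      (k.op, 𝟙 X.2)) h).trans ((protoBody.{u, v, max u v} Val).map_id _)
  map_comp {X Y Z} f g := by
    have h := P.map_comp (X := (op Z.2, Z.1.unop)) (Y := (op Y.2, Y.1.unop))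
      (Z := (op X.2, X.1.unop)) (g.2.op, g.1.unop) (f.2.op, f.1.unop)
    exact (congrArg (fun k => (protoBody.{u, v, max u v} Val).map
      (X := (op (P.obj (op X.2, X.1.unop)), X.2)) (Y := (op (P.obj (op Z.2, Z.1.unop)), Z.2))
      (k.op, f.2 ≫ g.2)) h).trans ((protoBody.{u, v, max u v} Val).map_comp
        (X := (op (P.obj (op X.2, X.1.unop)), X.2)) (Y := (op (P.obj (op Y.2, Y.1.unop)), Y.2))
        (Z := (op (P.obj (op Z.2, Z.1.unop)), Z.2))
        ((P.map (X := (op Y.2, Y.1.unop)) (Y := (op X.2, X.1.unop)) (f.2.op, f.1.unop)).op, f.2)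
        ((P.map (X := (op Z.2, Z.1.unop)) (Y := (op Y.2, Y.1.unop)) (g.2.op, g.1.unop)).op, g.2))

/-- The once-unfolded functor with fixed parameters `X⁻`, `X⁺`:
`B ↦ 1 + (Action × (Val → ▶(1 + (Action × (Val → ▶B → X⁻))) → X⁺))`. -/
def proto₂ (Val : Type v) (Xneg Xpos : CofeCat.{u}) : CofeCat.{max u v} ⥤ CofeCat.{max u v} where
  obj B := (protoBody.{u, v, max u v} Val).obj
    (op ((protoBody.{u, v, max u v} Val).obj (op B, Xneg)), Xpos)
  map {B C} f := (protoBody.{u, v, max u v} Val).map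
    (X := (op ((protoBody.{u, v, max u v} Val).obj (op B, Xneg)), Xpos))
    (Y := (op ((protoBody.{u, v, max u v} Val).obj (op C, Xneg)), Xpos))
    (((protoBody.{u, v, max u v} Val).map (X := (op C, Xneg)) (Y := (op B, Xneg))
      (f.op, 𝟙 Xneg)).op, 𝟙 Xpos)
  map_id B := by
    apply NonExp.ext
    funext x
    rcases x with x | ⟨a, φ⟩
    · rfl
    · refine congrArg (fun ψ => Sum.inr (a, ψ)) (funext fun v => NonExp.ext (funext fun y => ?_))
      rcases y with ⟨y | y⟩ <;> rfl
  map_comp f g := by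
    apply NonExp.ext
    funext x
    rcases x with x | ⟨a, φ⟩
    · rfl
    · refine congrArg (fun ψ => Sum.inr (a, ψ)) (funext fun v => NonExp.ext (funext fun y => ?_))
      rcases y with ⟨y | y⟩ <;> rfl

/-- If `P(X⁻, X⁺) ≅ 1 + (Action × (Val → ▶P(X⁺, X⁻) → X⁺))`, then unfolding this isomorphism
once more, at `(X⁺, X⁻)`, makes `P(X⁻, X⁺)` a solution of the once-unfolded equation. -/
def unfoldedSolution (Val : Type v) (P : CofeCat.{u}ᵒᵖ × CofeCat.{u} ⥤ CofeCat.{max u v})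
    (e : P ≅ protoRHS Val P) (Xneg Xpos : CofeCat.{u}) : Solution (proto₂ Val Xneg Xpos) where
  car := P.obj (op Xneg, Xpos)
  fold := (protoBody.{u, v, max u v} Val).mapIso
    (X := (op ((protoBody.{u, v, max u v} Val).obj (op (P.obj (op Xneg, Xpos)), Xneg)), Xpos))
    (Y := (op (P.obj (op Xpos, Xneg)), Xpos))
    (Iso.prod (e.app (op Xpos, Xneg)).op (Iso.refl Xpos)) ≪≫ (e.app (op Xneg, Xpos)).symm

/-! Fixed points of contractive maps. -/

namespace OFE

variable {α : Type u} [OFE α] {n : ℕ} {x y z : α}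

/-! Everything rests on Banach's fixed-point theorem in COFEs of morphisms: a contractive self-map
of an inhabited COFE has exactly one fixed point (`Contractive.exists_fixed`,
`Contractive.fixed_unique`). For a locally contractive `F` with `F(1)` inhabited, the limit of the
iterates `Fⁿ(1)` solves `F(T) ≅ T` (`nonempty_solution`). Any two inhabited solutions are
isomorphic, because `h ↦ fold⁻¹ ≫ F h ≫ fold` is contractive (`solution_isomorphic`).

Write `G_X(A) = 1 + (Action × (Val → ▶A → X))`, so that the once-unfolded functor is `G_Y ∘ G_X`; it
is locally contractive because its argument is guarded by `▶`. Let `iProto(X, Y)` be a solution. Its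
action on morphisms is again a unique fixed point, whence functoriality and local non-expansiveness.
If `T` solves the equation for `(X, Y)`, then `G_X(T)` solves it for `(Y, X)`; uniqueness yields
`iProto(Y, X) ≅ G_X(iProto(X, Y))`, and naturality is one more comparison of fixed points. -/

theorem dist_refl (n : ℕ) (x : α) : dist n x x := (dist_equiv n).refl x

theorem dist_symm (h : dist n x y) : dist n y x := (dist_equiv n).symm h

theorem dist_trans (h : dist n x y) (k : dist n y z) : dist n x z := (dist_equiv n).trans h k

theorem dist_of_eq (n : ℕ) (h : x = y) : dist n x y := h ▸ dist_refl n x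

theorem isChain_of_succ {c : ℕ → α} (h : ∀ n, dist n (c (n + 1)) (c n)) : IsChain c := by
  intro n m hnm
  induction m, hnm using Nat.le_induction with
  | base => exact dist_refl _ _
  | succ m hnm ih => exact dist_trans (dist_mono hnm (h m)) ih

/-- A self-map is contractive if it turns equality below `n` into `n`-equality. -/
def Contractive (Φ : α → α) : Prop :=
  ∀ n x y, (∀ m, m < n → dist m x y) → dist n (Φ x) (Φ y)

/-- Strong induction up to `n`: `x = Φ x`, then `Φ x` and `Φ y` agree by contractivity, and `Φ y`
agrees with `Ψ y = y`. Taking `Ψ = Φ` gives uniqueness; a different `Ψ` shows that fixed points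
depend non-expansively on parameters. -/
theorem Contractive.dist_of_fixed {Φ Ψ : α → α} (hΦ : Contractive Φ) (hx : Φ x = x) (hy : Ψ y = y)
    (h : dist n (Φ y) (Ψ y)) : dist n x y := by
  have key : ∀ m, m ≤ n → dist m x y := by
    intro m
    induction m using Nat.strong_induction_on with
    | _ m ih =>
      intro hm
      have h₁ : dist m (Φ x) (Φ y) := hΦ m x y fun k hk => ih k hk (hk.le.trans hm)
      rw [hx] at h₁
      exact dist_trans h₁ (dist_trans (dist_mono hm h) (dist_of_eq m hy))
  exact key n le_rfl

theorem Contractive.fixed_unique {Φ : α → α} (hΦ : Contractive Φ) (hx : Φ x = x) (hy : Φ y = y) :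
    x = y :=
  eq_of_dist fun n => hΦ.dist_of_fixed hx hy (dist_refl n _)

theorem Contractive.exists_fixed {α : Type u} [COFE α] [Nonempty α] {Φ : α → α}
    (hΦ : Contractive Φ) : ∃ x, Φ x = x := by
  obtain ⟨a⟩ := ‹Nonempty α›
  -- The iteration starts at `Φ a`: `0`-equality need not be total, but any two values of `Φ` are
  -- `0`-equal, the contractivity hypothesis being vacuous at `0`.
  have hc : ∀ n, dist n (Φ^[n + 2] a) (Φ^[n + 1] a) := by
    intro n
    induction n with
    | zero => exact hΦ 0 _ _ fun m hm => absurd hm (Nat.not_lt_zero m)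
    | succ n ih =>
      rw [Function.iterate_succ_apply' Φ (n + 2), Function.iterate_succ_apply' Φ (n + 1)]
      refine hΦ _ _ _ fun m hm => dist_mono (Nat.le_of_lt_succ hm) ?_
      rwa [← Function.iterate_succ_apply' Φ (n + 1)]
  obtain ⟨x, hx⟩ := COFE.complete (fun n => Φ^[n + 1] a) (isChain_of_succ hc)
  refine ⟨x, eq_of_dist fun n => ?_⟩
  have h : dist n (Φ x) (Φ (Φ^[n + 1] a)) := hΦ _ _ _ fun m hm => dist_mono hm.le (hx n)
  rw [← Function.iterate_succ_apply' Φ] at h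
  exact dist_trans h (dist_trans (hc n) (dist_symm (hx n)))

end OFE

/-! ### Morphisms as elements of a COFE -/

namespace CofeCat

open OFE

variable {A B C : CofeCat.{u}} {n : ℕ}

instance (A B : CofeCat.{u}) : COFE (A ⟶ B) := inferInstanceAs (COFE (NonExp A.carrier B.carrier))

theorem dist_comp {f f' : A ⟶ B} {g g' : B ⟶ C} (hf : dist n f f') (hg : dist n g g') :
    dist n (f ≫ g) (f' ≫ g') := fun x =>
  dist_trans (g.nonexp n _ _ (hf x)) (hg (f'.toFun x))

theorem hom_ext {f g : A ⟶ B} (h : ∀ x, f.toFun x = g.toFun x) : f = g := NonExp.ext (funext h)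

/-- The constant morphism. -/
def const (A : CofeCat.{u}) (b : B.carrier) : A ⟶ B where
  toFun _ := b
  nonexp n _ _ _ := dist_refl n b

/-- The one-point COFE. -/
abbrev one : CofeCat.{u} := ⟨PUnit⟩

theorem hom_one_ext (f g : A ⟶ one) : f = g := hom_ext fun _ => rfl

end CofeCat

/-! Solutions of locally contractive domain equations. -/

namespace LocallyContractive

open OFE CofeCat

/-! ### Existence: the limit of the iterates -/

section Tower

variable (F : CofeCat.{u} ⥤ CofeCat.{u})

/-- The iterates of `F` on the one-point COFE. -/
def iter : ℕ → CofeCat.{u}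
  | 0 => one
  | n + 1 => F.obj (iter n)

/-- The projections between successive iterates. -/
def proj : ∀ n, iter F (n + 1) ⟶ iter F n
  | 0 => const _ PUnit.unit
  | n + 1 => F.map (proj n)

/-- The limit of the iterates along the projections. -/
def Tower : Type u :=
  { x : ∀ n, (iter F n).carrier // ∀ n, (proj F n).toFun (x (n + 1)) = x n }

instance : COFE (Tower F) where
  dist n x y := ∀ k, dist n (x.1 k) (y.1 k)
  dist_equiv _ := ⟨fun _ _ => dist_refl _ _, fun h k => dist_symm (h k),
    fun h h' k => dist_trans (h k) (h' k)⟩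
  dist_mono hmn h k := dist_mono hmn (h k)
  eq_of_dist h := Subtype.ext (funext fun k => eq_of_dist fun n => h n k)
  complete c hc := by
    have h : ∀ k, ∃ y, ∀ n, dist n y ((c n).1 k) := fun k =>
      COFE.complete (fun n => (c n).1 k) (fun n m hnm => hc n m hnm k)
    choose y hy using h
    refine ⟨⟨y, fun k => eq_of_dist fun n => ?_⟩, fun n k => hy k n⟩
    have h₁ := (proj F k).nonexp n _ _ (hy (k + 1) n)
    rw [(c n).2 k] at h₁
    exact dist_trans h₁ (dist_symm (hy k n))

/-- The limit of the iterates, as a bundled COFE. -/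
def tower : CofeCat.{u} := ⟨Tower F⟩

/-- The projection of the limit to an iterate. -/
def towerProj (n : ℕ) : tower F ⟶ iter F n where
  toFun x := Subtype.val x n
  nonexp _ _ _ h := h n

theorem towerProj_proj (n : ℕ) : towerProj F (n + 1) ≫ proj F n = towerProj F n :=
  hom_ext fun x => Subtype.property x n

variable {F} in
theorem tower_hom_dist {A : CofeCat.{u}} {n : ℕ} {f g : A ⟶ tower F}
    (h : ∀ k, dist n (f ≫ towerProj F k) (g ≫ towerProj F k)) : dist n f g :=
  fun x k => h k x

/-- The morphism into the limit induced by a cone. -/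
def towerLift {A : CofeCat.{u}} (f : ∀ n, A ⟶ iter F n) (hf : ∀ n, f (n + 1) ≫ proj F n = f n) :
    A ⟶ tower F where
  toFun x := ⟨fun n => (f n).toFun x, fun n => congrArg (fun g => NonExp.toFun g x) (hf n)⟩
  nonexp n x y h k := (f k).nonexp n x y h

variable (s : (F.obj one).carrier)

/-- The morphisms between arbitrary iterates: compositions of projections when the index
decreases, of embeddings when it increases. -/
def trans : ∀ k n, iter F k ⟶ iter F n
  | _, 0 => const _ PUnit.unit
  | 0, n + 1 => (const one s : one ⟶ F.obj one) ≫ F.map (trans 0 n)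
  | k + 1, n + 1 => F.map (trans k n)

theorem trans_proj (k n : ℕ) : trans F s k (n + 1) ≫ proj F n = trans F s k n := by
  induction n generalizing k with
  | zero => exact hom_one_ext _ _
  | succ n ih =>
    have h : ∀ k, F.map (trans F s k (n + 1)) ≫ F.map (proj F n) = F.map (trans F s k n) :=
      fun k => (F.map_comp _ _).symm.trans (congrArg F.map (ih k))
    cases k with
    | zero => exact congrArg (fun g => (const one s : one ⟶ F.obj one) ≫ g) (h 0)
    | succ k => exact h k

theorem trans_self (n : ℕ) : trans F s n n = 𝟙 _ := by
  induction n with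
  | zero => exact hom_one_ext _ _
  | succ n ih =>
    simp only [trans]
    rw [ih]
    exact F.map_id _

variable {F} (hF : LocallyContractive F)

include hF

/-- Projecting and embedding back loses information, so this square commutes only up to
`m`-equality. Each application of `F` gains one level, which matches the increase of `k`. -/
theorem proj_trans_dist {m k : ℕ} (n : ℕ) (hm : m < k) :
    dist m (proj F k ≫ trans F s k n) (trans F s (k + 1) n) := by
  induction n generalizing k m with
  | zero => exact dist_of_eq m (hom_one_ext _ _)
  | succ n ih =>
    cases k with
    | zero => omega
    | succ k =>
      have h : dist m (F.map (proj F k ≫ trans F s k n)) (F.map (trans F s (k + 1) n)) :=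
        hF _ _ _ _ _ fun i hi => ih (by omega)
      rw [F.map_comp] at h
      exact h

omit hF in
theorem towerProj_trans_of_le {k n : ℕ} (h : n ≤ k) :
    towerProj F k ≫ trans F s k n = towerProj F n := by
  induction h using Nat.decreasingInduction with
  | self => rw [trans_self, Category.comp_id]
  | of_succ n _ ih => rw [← trans_proj, ← Category.assoc, ih, towerProj_proj]

theorem towerProj_trans_dist {m k : ℕ} (n : ℕ) (hm : m < k) :
    dist m (towerProj F k ≫ trans F s k n) (towerProj F n) := by
  rcases le_total n k with h | h
  · exact dist_of_eq m (towerProj_trans_of_le s h)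
  · induction h using Nat.decreasingInduction with
    | self => exact dist_of_eq m (towerProj_trans_of_le s le_rfl)
    | of_succ k _ ih =>
      refine dist_trans ?_ (ih (by omega))
      rw [← towerProj_proj, Category.assoc]
      exact dist_comp (dist_refl _ _) (proj_trans_dist s hF n hm)

omit hF in
variable (F) in
/-- The embedding of an iterate into the limit. -/
def towerEmb (k : ℕ) : iter F k ⟶ tower F := towerLift F (trans F s k) (trans_proj F s k)

theorem proj_towerEmb_dist {m k : ℕ} (hm : m < k) :
    dist m (proj F k ≫ towerEmb F s k) (towerEmb F s (k + 1)) :=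
  tower_hom_dist fun n => proj_trans_dist s hF n hm

/-- The limit is approximated by its finite stages; this makes folding and unfolding mutually
inverse. -/
theorem towerProj_towerEmb_dist {m k : ℕ} (hm : m < k) :
    dist m (towerProj F k ≫ towerEmb F s k) (𝟙 (tower F)) :=
  tower_hom_dist fun n => towerProj_trans_dist s hF n hm

omit hF in
variable (F) in
/-- The projections of `F` applied to the limit. -/
def foldProj : ∀ n, F.obj (tower F) ⟶ iter F n
  | 0 => const _ PUnit.unit
  | n + 1 => F.map (towerProj F n)

omit hF in
theorem foldProj_proj (n : ℕ) : foldProj F (n + 1) ≫ proj F n = foldProj F n := by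
  cases n with
  | zero => exact hom_one_ext _ _
  | succ n => exact (F.map_comp _ _).symm.trans (congrArg F.map (towerProj_proj F n))

omit hF in
variable (F) in
/-- The folding map of the limit. -/
def towerFold : F.obj (tower F) ⟶ tower F := towerLift F (foldProj F) foldProj_proj

omit hF in
variable (F) in
/-- The approximations of the unfolding map of the limit. -/
def unfoldApprox (n : ℕ) : tower F ⟶ F.obj (tower F) :=
  (towerProj F (n + 1) : tower F ⟶ F.obj (iter F n)) ≫ F.map (towerEmb F s n)

theorem unfoldApprox_dist (n : ℕ) :
    dist n (unfoldApprox F s (n + 1)) (unfoldApprox F s n) := by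
  -- Both approximations are factored through stage `n + 2`, so that they differ only inside
  -- `F.map`, where `m`-equality for `m < n` suffices.
  have h : unfoldApprox F s n = (towerProj F (n + 2) : tower F ⟶ F.obj (iter F (n + 1))) ≫
      F.map (proj F n ≫ towerEmb F s n) := by
    rw [unfoldApprox, ← towerProj_proj, F.map_comp]
    rfl
  rw [h]
  refine dist_comp (dist_refl _ _) (hF _ _ _ _ _ fun m hm => ?_)
  exact dist_symm (proj_towerEmb_dist s hF hm)

theorem nonempty_solution (s : (F.obj one).carrier) : Nonempty (Solution F) := by
  -- The unfolding map is the limit of the approximations; both inverse laws are checked up to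
  -- `k`-equality with `u` replaced by its `k`-th approximation.
  obtain ⟨u, hu⟩ := COFE.complete _ (isChain_of_succ (unfoldApprox_dist s hF))
  refine ⟨⟨tower F, ⟨towerFold F, u, ?_, ?_⟩⟩⟩
  · refine eq_of_dist fun k => dist_trans (dist_comp (dist_refl _ _) (hu k)) ?_
    have h : towerFold F ≫ unfoldApprox F s k = F.map (towerProj F k ≫ towerEmb F s k) := by
      rw [F.map_comp]; rfl
    rw [h, ← F.map_id]
    exact hF _ _ _ _ _ fun m hm => towerProj_towerEmb_dist s hF hm
  · refine eq_of_dist fun k => dist_trans (dist_comp (hu k) (dist_refl _ _)) ?_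
    refine tower_hom_dist fun n => ?_
    cases n with
    | zero => exact dist_of_eq k (hom_one_ext _ _)
    | succ n =>
      have h : (unfoldApprox F s k ≫ towerFold F) ≫ towerProj F (n + 1) =
          towerProj F (k + 1) ≫ trans F s (k + 1) (n + 1) := by
        have h₁ : F.map (towerEmb F s k) ≫ F.map (towerProj F n) = F.map (trans F s k n) := by
          rw [← F.map_comp]; rfl
        exact congrArg (fun g => towerProj F (k + 1) ≫ g) h₁
      rw [h]
      exact towerProj_trans_dist s hF (n + 1) (Nat.lt_succ_self k)

end Tower

/-! ### Uniqueness of solutions -/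

variable {F : CofeCat.{u} ⥤ CofeCat.{u}} (hF : LocallyContractive F)

include hF

theorem contractive_conj {A B : CofeCat.{u}} (a : A ⟶ F.obj A) (b : F.obj B ⟶ B) :
    Contractive fun h : A ⟶ B => a ≫ F.map h ≫ b := fun n _ _ h =>
  dist_comp (dist_refl n _) (dist_comp (hF _ _ _ _ n h) (dist_refl n _))

theorem exists_solution_hom (S T : Solution F) (t : T.car.carrier) :
    ∃ h : S.car ⟶ T.car, S.fold.inv ≫ F.map h ≫ T.fold.hom = h :=
  haveI : Nonempty (S.car ⟶ T.car) := ⟨const _ t⟩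
  (hF.contractive_conj S.fold.inv T.fold.hom).exists_fixed

/-- The composite and the identity are both fixed points of conjugation by the folding isomorphism
of `S`. -/
theorem comp_solution_hom {S T : Solution F} {h : S.car ⟶ T.car} {k : T.car ⟶ S.car}
    (hh : S.fold.inv ≫ F.map h ≫ T.fold.hom = h) (hk : T.fold.inv ≫ F.map k ≫ S.fold.hom = k) :
    h ≫ k = 𝟙 _ := by
  refine (hF.contractive_conj S.fold.inv S.fold.hom).fixed_unique ?_ (by simp)
  conv_rhs => rw [← hh, ← hk]
  simp

theorem solution_isomorphic (S T : Solution F) (s : S.car.carrier) (t : T.car.carrier) :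
    S.Isomorphic T := by
  obtain ⟨h, hh⟩ := hF.exists_solution_hom S T t
  obtain ⟨k, hk⟩ := hF.exists_solution_hom T S s
  refine ⟨⟨h, k, hF.comp_solution_hom hh hk, hF.comp_solution_hom hk hh⟩, ?_⟩
  exact (Iso.eq_inv_comp S.fold).1 hh.symm

end LocallyContractive

/-! The protocol equations. -/

section Protocols

open OFE CofeCat

variable (Val : Type v)

/-- The COFE `1 + (Action × (Val → ▶A → X))`. -/
abbrev bodyObj (A : CofeCat.{max u v}) (X : CofeCat.{u}) : CofeCat.{max u v} :=
  (protoBody.{u, v, max u v} Val).obj (op A, X)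

/-- The action of `bodyObj` on morphisms. -/
def bodyMap {A A' : CofeCat.{max u v}} {X X' : CofeCat.{u}} (a : A' ⟶ A) (g : X ⟶ X') :
    bodyObj Val A X ⟶ bodyObj Val A' X' :=
  (protoBody.{u, v, max u v} Val).map (X := (op A, X)) (Y := (op A', X')) (a.op, g)

variable {Val}

theorem bodyMap_id (A : CofeCat.{max u v}) (X : CofeCat.{u}) :
    bodyMap Val (𝟙 A) (𝟙 X) = 𝟙 _ :=
  (protoBody.{u, v, max u v} Val).map_id (op A, X)

theorem bodyMap_comp {A A' A'' : CofeCat.{max u v}} {X X' X'' : CofeCat.{u}} (a : A' ⟶ A)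
    (a' : A'' ⟶ A') (g : X ⟶ X') (g' : X' ⟶ X'') :
    bodyMap Val a g ≫ bodyMap Val a' g' = bodyMap Val (a' ≫ a) (g ≫ g') :=
  ((protoBody.{u, v, max u v} Val).map_comp (X := (op A, X)) (Y := (op A', X'))
    (Z := (op A'', X'')) (a.op, g) (a'.op, g')).symm

/-- The action of `bodyObj` on isomorphisms in its contravariant argument. -/
def bodyIso {A A' : CofeCat.{max u v}} (i : A ≅ A') (X : CofeCat.{u}) :
    bodyObj Val A X ≅ bodyObj Val A' X where
  hom := bodyMap Val i.inv (𝟙 X)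
  inv := bodyMap Val i.hom (𝟙 X)
  hom_inv_id := by rw [bodyMap_comp, Iso.hom_inv_id, Category.id_comp, bodyMap_id]
  inv_hom_id := by rw [bodyMap_comp, Iso.inv_hom_id, Category.id_comp, bodyMap_id]

/-- The contravariant argument sits under `▶`, so equality below `n` is enough there; this is the
source of all contractivity below. -/
theorem bodyMap_dist {A A' : CofeCat.{max u v}} {X X' : CofeCat.{u}} {n : ℕ} {a a' : A' ⟶ A}
    {g g' : X ⟶ X'} (ha : ∀ m, m < n → dist m a a') (hg : dist n g g') :
    dist n (bodyMap Val a g) (bodyMap Val a' g') := by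
  rintro (x | ⟨i, φ⟩)
  · exact .inl rfl
  · refine .inr ⟨rfl, fun x y => dist_trans (g.nonexp n _ _ ?_) (hg _)⟩
    exact (φ x).nonexp n _ _ fun m hm => ha m hm _

theorem proto₂_locallyContractive (X Y : CofeCat.{u}) : LocallyContractive (proto₂ Val X Y) :=
  fun _ _ _ _ _ h => bodyMap_dist (fun m hm => bodyMap_dist
    (fun k hk => h k (hk.trans hm)) (dist_refl m _)) (dist_refl _ _)

variable (Val) in
/-- A solution of the once-unfolded protocol equation. -/
noncomputable def protoSol (X Y : CofeCat.{u}) : Solution (proto₂ Val X Y) :=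
  ((proto₂_locallyContractive X Y).nonempty_solution (.inl ⟨⟩)).some

variable (Val) in
/-- The COFE of protocols. -/
noncomputable abbrev protoCar (X Y : CofeCat.{u}) : CofeCat.{max u v} := (protoSol Val X Y).car

variable (Val) in
/-- The folding isomorphism of the once-unfolded protocol equation. -/
noncomputable abbrev protoFold (X Y : CofeCat.{u}) :
    bodyObj Val (bodyObj Val (protoCar Val X Y) X) Y ≅ protoCar Val X Y := (protoSol Val X Y).fold

/-- Every solution of the once-unfolded equation has the element that represents the finished
protocol. -/
def Solution.finished {X Y : CofeCat.{u}} (S : Solution (proto₂ Val X Y)) : S.car.carrier :=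
  S.fold.hom.toFun (.inl ⟨⟩)

/-! ### The action of protocols on morphisms -/

/-- The maps `a` and `b` are arbitrary, since naturality of `protoDual` needs a target that is a
dual solution, not only a `protoCar`. -/
theorem contractive_bodyMap {A B : CofeCat.{max u v}} {X X' Y Y' : CofeCat.{u}}
    (a : A ⟶ bodyObj Val (bodyObj Val A X) Y) (b : bodyObj Val (bodyObj Val B X') Y' ⟶ B)
    (f : X' ⟶ X) (g : Y ⟶ Y') :
    Contractive fun h : A ⟶ B => a ≫ bodyMap Val (bodyMap Val h f) g ≫ b := fun n _ _ h =>
  dist_comp (dist_refl n _) (dist_comp (bodyMap_dist (fun m hm => bodyMap_dist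
    (fun k hk => h k (hk.trans hm)) (dist_refl m _)) (dist_refl n _)) (dist_refl n _))

theorem exists_protoMap {X X' Y Y' : CofeCat.{u}} (f : X' ⟶ X) (g : Y ⟶ Y') :
    ∃ h : protoCar Val X Y ⟶ protoCar Val X' Y',
      (protoFold Val X Y).inv ≫ bodyMap Val (bodyMap Val h f) g ≫ (protoFold Val X' Y').hom = h :=
  haveI : Nonempty (protoCar Val X Y ⟶ protoCar Val X' Y') := ⟨const _ (Solution.finished _)⟩
  (contractive_bodyMap _ _ f g).exists_fixed

variable (Val) in
/-- The action of `protoCar` on morphisms. -/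
noncomputable def protoMap {X X' Y Y' : CofeCat.{u}} (f : X' ⟶ X) (g : Y ⟶ Y') :
    protoCar Val X Y ⟶ protoCar Val X' Y' := (exists_protoMap f g).choose

theorem protoMap_spec {X X' Y Y' : CofeCat.{u}} (f : X' ⟶ X) (g : Y ⟶ Y') :
    (protoFold Val X Y).inv ≫ bodyMap Val (bodyMap Val (protoMap Val f g) f) g ≫
      (protoFold Val X' Y').hom = protoMap Val f g := (exists_protoMap f g).choose_spec

theorem protoMap_unique {X X' Y Y' : CofeCat.{u}} {f : X' ⟶ X} {g : Y ⟶ Y'}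
    {h : protoCar Val X Y ⟶ protoCar Val X' Y'}
    (hh : (protoFold Val X Y).inv ≫ bodyMap Val (bodyMap Val h f) g ≫
      (protoFold Val X' Y').hom = h) : protoMap Val f g = h :=
  (contractive_bodyMap _ _ f g).fixed_unique (protoMap_spec f g) hh

theorem protoFold_comp_protoMap {X X' Y Y' : CofeCat.{u}} (f : X' ⟶ X) (g : Y ⟶ Y') :
    (protoFold Val X Y).hom ≫ protoMap Val f g =
      bodyMap Val (bodyMap Val (protoMap Val f g) f) g ≫ (protoFold Val X' Y').hom :=
  (Iso.eq_inv_comp _).1 (protoMap_spec f g).symm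

theorem protoMap_comp_protoFold_inv {X X' Y Y' : CofeCat.{u}} (f : X' ⟶ X) (g : Y ⟶ Y') :
    protoMap Val f g ≫ (protoFold Val X' Y').inv =
      (protoFold Val X Y).inv ≫ bodyMap Val (bodyMap Val (protoMap Val f g) f) g := by
  rw [Iso.comp_inv_eq, Category.assoc, protoMap_spec]

theorem protoMap_id (X Y : CofeCat.{u}) : protoMap Val (𝟙 X) (𝟙 Y) = 𝟙 _ :=
  protoMap_unique (by rw [bodyMap_id, bodyMap_id, Category.id_comp, Iso.inv_hom_id])

theorem protoMap_comp {X X' X'' Y Y' Y'' : CofeCat.{u}} (f : X' ⟶ X) (f' : X'' ⟶ X')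
    (g : Y ⟶ Y') (g' : Y' ⟶ Y'') :
    protoMap Val (f' ≫ f) (g ≫ g') = protoMap Val f g ≫ protoMap Val f' g' := by
  refine protoMap_unique ?_
  -- The composite solves the equation that characterizes the left side: the folding map slides past
  -- the second factor, and `protoMap_spec` absorbs the first.
  rw [← bodyMap_comp, ← bodyMap_comp, Category.assoc, ← protoFold_comp_protoMap,
    ← Category.assoc, ← Category.assoc, Category.assoc (protoFold Val X Y).inv, protoMap_spec]

theorem protoMap_dist {X X' Y Y' : CofeCat.{u}} {n : ℕ} {f f' : X' ⟶ X} {g g' : Y ⟶ Y'}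
    (hf : dist n f f') (hg : dist n g g') : dist n (protoMap Val f g) (protoMap Val f' g') := by
  refine (contractive_bodyMap _ _ f g).dist_of_fixed (Ψ := fun h => (protoFold Val X Y).inv ≫
    bodyMap Val (bodyMap Val h f') g' ≫ (protoFold Val X' Y').hom)
    (protoMap_spec f g) (protoMap_spec f' g') ?_
  exact dist_comp (dist_refl n _) (dist_comp (bodyMap_dist (fun m hm =>
    bodyMap_dist (fun _ _ => dist_refl _ _) (dist_mono hm.le hf)) hg) (dist_refl n _))

variable (Val) in
/-- The bifunctor of protocols. -/
noncomputable def protoFunctor : CofeCat.{u}ᵒᵖ × CofeCat.{u} ⥤ CofeCat.{max u v} where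
  obj p := protoCar Val p.1.unop p.2
  map f := protoMap Val f.1.unop f.2
  map_id p := protoMap_id p.1.unop p.2
  map_comp f g := protoMap_comp f.1.unop g.1.unop f.2 g.2

/-! ### The single unfolding and its naturality -/

/-- Unfolding a solution with exchanged polarities. -/
def Solution.dual {X Y : CofeCat.{u}} (S : Solution (proto₂ Val X Y)) :
    Solution (proto₂ Val Y X) where
  car := bodyObj Val S.car X
  fold := bodyIso S.fold X

theorem exists_protoDual (X Y : CofeCat.{u}) :
    ∃ j : protoCar Val Y X ≅ bodyObj Val (protoCar Val X Y) X,
      (protoFold Val Y X).hom ≫ j.hom =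
        bodyMap Val (bodyMap Val j.hom (𝟙 Y)) (𝟙 X) ≫
          bodyMap Val (protoFold Val X Y).inv (𝟙 X) :=
  (proto₂_locallyContractive Y X).solution_isomorphic (protoSol Val Y X) (protoSol Val X Y).dual
    (Solution.finished _) (Solution.finished _)

variable (Val) in
/-- The unfolding isomorphism that exchanges polarities. -/
noncomputable def protoDual (X Y : CofeCat.{u}) :
    protoCar Val Y X ≅ bodyObj Val (protoCar Val X Y) X := (exists_protoDual X Y).choose

theorem protoDual_spec (X Y : CofeCat.{u}) :
    (protoFold Val Y X).hom ≫ (protoDual Val X Y).hom =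
      bodyMap Val (bodyMap Val (protoDual Val X Y).hom (𝟙 Y)) (𝟙 X) ≫
        bodyMap Val (protoFold Val X Y).inv (𝟙 X) := (exists_protoDual X Y).choose_spec

/-- Both sides are fixed points of one contractive map, built from the folding isomorphism at `(Y,
X)` and that of the dual solution at `(X', Y')`. -/
theorem protoDual_natural {X X' Y Y' : CofeCat.{u}} (f : X ⟶ X') (g : Y' ⟶ Y) :
    protoMap Val g f ≫ (protoDual Val X' Y').hom =
      (protoDual Val X Y).hom ≫ bodyMap Val (protoMap Val f g) f := by
  refine (contractive_bodyMap (protoFold Val Y X).inv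
    (bodyMap Val (protoFold Val X' Y').inv (𝟙 X')) g f).fixed_unique ?_ ?_
  · have h : bodyMap Val (bodyMap Val (protoMap Val g f ≫ (protoDual Val X' Y').hom) g) f =
        bodyMap Val (bodyMap Val (protoMap Val g f) g) f ≫
          bodyMap Val (bodyMap Val (protoDual Val X' Y').hom (𝟙 Y')) (𝟙 X') := by
      rw [bodyMap_comp, bodyMap_comp, Category.id_comp, Category.comp_id]
    rw [h, Category.assoc, ← protoDual_spec, ← Category.assoc, ← Category.assoc,
      Category.assoc (protoFold Val Y X).inv, protoMap_spec]
  · have h : bodyMap Val (bodyMap Val ((protoDual Val X Y).hom ≫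
          bodyMap Val (protoMap Val f g) f) g) f =
        bodyMap Val (bodyMap Val (protoDual Val X Y).hom (𝟙 Y)) (𝟙 X) ≫
          bodyMap Val (bodyMap Val (bodyMap Val (protoMap Val f g) f) g) f := by
      rw [bodyMap_comp, bodyMap_comp, Category.id_comp, Category.comp_id]
    have h' : bodyMap Val (bodyMap Val (bodyMap Val (protoMap Val f g) f) g) f ≫
          bodyMap Val (protoFold Val X' Y').inv (𝟙 X') =
        bodyMap Val (protoFold Val X Y).inv (𝟙 X) ≫ bodyMap Val (protoMap Val f g) f := by
      rw [bodyMap_comp, bodyMap_comp, ← protoMap_comp_protoFold_inv, Category.id_comp,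
        Category.comp_id]
    rw [h, Category.assoc, h', ← Category.assoc (bodyMap Val _ _), ← protoDual_spec,
      Category.assoc, Iso.inv_hom_id_assoc]

end Protocols

theorem mainTheorem5 (Val : Type v) :
    (∀ Xneg Xpos : CofeCat.{u},
      LocallyContractive (proto₂ Val Xneg Xpos) ∧ Nonempty (Solution (proto₂ Val Xneg Xpos))) ∧
    ∃ iProto : CofeCat.{u}ᵒᵖ × CofeCat.{u} ⥤ CofeCat.{max u v},
      LocallyNonExpansive iProto ∧
      ∃ e : iProto ≅ protoRHS Val iProto,
        ∀ (Xneg Xpos : CofeCat.{u}) (iProto₂ : Solution (proto₂ Val Xneg Xpos)),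
          iProto₂.Isomorphic (unfoldedSolution Val iProto e Xneg Xpos) := by
  refine ⟨fun X Y => ⟨proto₂_locallyContractive X Y, ⟨protoSol Val X Y⟩⟩, protoFunctor Val,
    fun _ _ _ _ _ _ _ _ _ hf hg => protoMap_dist hf hg, ?_⟩
  refine ⟨NatIso.ofComponents (fun p => protoDual Val p.2 p.1.unop)
    fun f => protoDual_natural f.2 f.1.unop, fun X Y S => ?_⟩
  -- The twofold unfolding along `e` is just another solution, so uniqueness applies without
  -- relating it to `protoFold`.
  exact (proto₂_locallyContractive X Y).solution_isomorphic _ _ S.finished (Solution.finished _)
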